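/- Let $(\Omega,\mathcal F,\mathbb P)$ be an atomless probability space, $n\ge 1$, $\boldsymbol\mu\in\mathbb R^n$, $\Sigma\in\mathbb R^{n\times n}$ symmetric positive semidefinite, and $\Lambda:\mathbb R\to[0,1]$. For an increasing (non-strictly) $f:\mathbb R\to[0,1]$ put $$\tilde q_\Lambda^-(f)=\sup\{x\in\mathbb R: f(x)<\Lambda(x)\},\qquad \tilde q_\Lambda^+(f)=\sup\{x\in\mathbb R: f(x)\le\Lambda(x)\},$$ with values in $[-\infty,\infty]$ and $\sup\emptyset=-\infty$. For a set $\mathcal M$ of cdfs on $\mathbb R$ let $F^-_{\mathcal M}(x)=\inf_{F\in\mathcal M}F(x)$. Let $\mathcal M_2$ be the set of cdfs on $\mathbb R$ with finite second moment, let $F^{-1}(t)=\inf\{x: F(x)\ge t\}$, and for $m\in\mathbb R$, $v\ge 0$ let $$\mathcal M_2(m,v)=\Big\{F\in\mathcal M_2:\ \int_0^1F^{-1}(t)\,dt=m,\ \int_0^1|F^{-1}(t)-m|^2\,dt\le v^2\Big\}.$$ Let $\Delta_n=\{\mathbf w\in[0,1]^n:\sum_i w_i=1\}$, and for $\mathbf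 w\in\Delta_n$ let $$\widehat{\mathcal M}(\mathbf w,\boldsymbol\mu,\Sigma)=\{F_{\mathbf w^\top\mathbf X}\in\mathcal M_2:\ \mathbb E[\mathbf X]=\boldsymbol\mu,\ \Sigma-\operatorname{Cov}(\mathbf X)\text{ positive semidefinite}\},$$ where $\mathbf X$ ranges over the square-integrable $\mathbb R^n$-valued random vectors on $(\Omega,\mathcal F,\mathbb P)$ and $F_{\mathbf w^\top\mathbf X}$ is the cdf of $\mathbf w^\top\mathbf X$. Let $\rho=\tilde q_\Lambda^-$, or let $\Lambda$ be decreasing (non-strictly) and $\rho=\tilde q_\Lambda^+$. Then both of the following minima are attained and $$\min_{\mathbf w\in\Delta_n}\ \sup_{F\in\widehat{\mathcal M}(\mathbf w,\boldsymbol\mu,\Sigma)}\rho(F)=\min_{\mathbf w\in\Delta_n}\rho\Big(F^-_{\mathcal M_2(\mathbf w^\top\boldsymbol\mu,\sqrt{\mathbf w^\top\Sigma\mathbf w})}\Big).$$ For every $\mathbf w\in\Delta_n$, $F^-_{\mathcal M_2(\mathbf w^\top\boldsymbol\mu,\sqrt{\mathbf w^\top\Sigma\mathbf w})}=F^-_{\widehat{\mathcal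 M}(\mathbf w,\boldsymbol\mu,\Sigma)}$, and for all $x\in\mathbb R$ $$F^-_{\widehat{\mathcal M}(\mathbf w,\boldsymbol\mu,\Sigma)}(x)=\frac{(x-\mathbf w^\top\boldsymbol\mu)^2}{\mathbf w^\top\Sigma\mathbf w+(x-\mathbf w^\top\boldsymbol\mu)^2}\,\mathbf 1_{\{x\ge\mathbf w^\top\boldsymbol\mu\}}\quad\text{if }\mathbf w^\top\Sigma\mathbf w>0,$$ while $F^-_{\widehat{\mathcal M}(\mathbf w,\boldsymbol\mu,\Sigma)}(x)=\mathbf 1_{\{x\ge\mathbf w^\top\boldsymbol\mu\}}$ if $\mathbf w^\top\Sigma\mathbf w=0$. Moreover, $\mathbf w\in\Delta_n$ is an optimal portfolio, i.e. minimizes the left-hand side over $\Delta_n$, if and only if it minimizes the right-hand side over $\Delta_n$. -/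

import Mathlib

open MeasureTheory ProbabilityTheory

noncomputable section

namespace RobustLambda

/-- A measure is atomless if every measurable set of positive measure has a measurable subset of
strictly smaller, still positive measure. -/
def Atomless {Ω : Type*} [MeasurableSpace Ω] (P : Measure Ω) : Prop :=
  ∀ A : Set Ω, MeasurableSet A → 0 < P A →
    ∃ B : Set Ω, B ⊆ A ∧ MeasurableSet B ∧ 0 < P B ∧ P B < P A

/-- `q̃⁻_Λ(f) = sup {x ∈ ℝ : f x < Λ x}`, an extended real, with `sup ∅ = -∞`. -/
def qTildeMinus (Lam f : ℝ → ℝ) : EReal :=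
  sSup ((fun x : ℝ => (x : EReal)) '' {x : ℝ | f x < Lam x})

/-- `q̃⁺_Λ(f) = sup {x ∈ ℝ : f x ≤ Λ x}`, an extended real, with `sup ∅ = -∞`. -/
def qTildePlus (Lam f : ℝ → ℝ) : EReal :=
  sSup ((fun x : ℝ => (x : EReal)) '' {x : ℝ | f x ≤ Lam x})

/-- The left quantile `F⁻¹(t) = inf {x : F x ≥ t}`. It is used for a cdf `F` and `t ∈ (0,1)` only,
where the set is non-empty and bounded below. -/
def leftQuantile (F : ℝ → ℝ) (t : ℝ) : ℝ := sInf {x : ℝ | t ≤ F x}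

/-- The set of all cdfs on `ℝ` with a finite second moment. -/
def cdfSetTwo : Set (ℝ → ℝ) :=
  {F | ∃ ν : Measure ℝ, IsProbabilityMeasure ν ∧ MemLp (fun x : ℝ => x) 2 ν ∧
    F = fun x => cdf ν x}

/-- `M₂(m, v)`: the cdfs in `cdfSetTwo` with mean `m` and second central moment at most `v²`. -/
def momentSet (m v : ℝ) : Set (ℝ → ℝ) :=
  {F | F ∈ cdfSetTwo ∧ ∫ t in Set.Ioo (0 : ℝ) 1, leftQuantile F t = m ∧
    ∫ t in Set.Ioo (0 : ℝ) 1, |leftQuantile F t - m| ^ 2 ≤ v ^ 2}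

/-- The covariance matrix of a random vector. -/
def covMat {Ω : Type*} [MeasurableSpace Ω] {n : ℕ} (P : Measure Ω) (X : Ω → Fin n → ℝ) :
    Matrix (Fin n) (Fin n) ℝ :=
  Matrix.of fun i j => covariance (fun ω => X ω i) (fun ω => X ω j) P

/-- The cdf of the portfolio loss `wᵀX`. -/
def portfolioCdf {Ω : Type*} [MeasurableSpace Ω] {n : ℕ} (P : Measure Ω) (w : Fin n → ℝ)
    (X : Ω → Fin n → ℝ) : ℝ → ℝ :=
  fun x => cdf (P.map fun ω => w ⬝ᵥ X ω) x

/-- The uncertainty set of the portfolio `w`: the cdfs with finite second moment of `wᵀX`, where `X`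
runs over the square-integrable random vectors on `(Ω, P)` with mean `mu` and covariance matrix
bounded above by `S` in the Loewner order. -/
def portfolioSet {Ω : Type*} [MeasurableSpace Ω] {n : ℕ} (P : Measure Ω) (w mu : Fin n → ℝ)
    (S : Matrix (Fin n) (Fin n) ℝ) : Set (ℝ → ℝ) :=
  {F | F ∈ cdfSetTwo ∧ ∃ X : Ω → Fin n → ℝ, Measurable X ∧
    (∀ i, MemLp (fun ω => X ω i) 2 P) ∧ (∀ i, ∫ ω, X ω i ∂P = mu i) ∧
    (S - covMat P X).PosSemidef ∧ F = portfolioCdf P w X}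

/-- The lower extremal function `F⁻_M(x) = inf_{F ∈ M} F x` of a set of cdfs. -/
def lowerExtremal (M : Set (ℝ → ℝ)) : ℝ → ℝ :=
  fun x => sInf ((fun F : ℝ → ℝ => F x) '' M)

end RobustLambda

end

/-! Write `m = w ⬝ᵥ mu` and `s = w ⬝ᵥ S.mulVec w`. Both uncertainty sets have the same lower
envelope, `cantelliBound m s`. Cantelli's inequality (`cantelliBound_le_cdf`) bounds the larger set
from below. The smaller one comes arbitrarily close (`exists_mem_portfolioSet_lt`): for `s > 0`
through `X = mu + s⁻¹ Y S w` with `Y` a centred two-point variable of variance `s`, whose rank-one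
covariance lies below `S` by Cauchy–Schwarz; for `s = 0` through `X = mu`.

The worst-case risk is then the risk of the envelope (`iSup_portfolioSet`). For `qTildeMinus` a
strict inequality at the envelope passes to some member of the set. For `qTildePlus` the infimum
need not be attained, and a small step to the left, harmless for decreasing `Lam`, compensates.

Both objectives thus equal one function of `(m, s)`. Its sublevel sets are closed in the compact
simplex, so a minimum exists (`exists_isMinOn_cantelliBound`). -/

open MeasureTheory ProbabilityTheory Filter Topology

namespace RobustLambda

/-! ### Intermediate values of atomless measures -/

section Atomless

variable {Ω : Type*} [MeasurableSpace Ω] {P : Measure Ω}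

lemma Atomless.exists_real [IsFiniteMeasure P] (hP : Atomless P) {A : Set Ω}
    (hA : MeasurableSet A) (h : 0 < P.real A) :
    ∃ B ⊆ A, MeasurableSet B ∧ 0 < P.real B ∧ P.real B < P.real A := by
  obtain ⟨B, hBA, hB, h0, h1⟩ := hP A hA (ENNReal.toReal_pos_iff.1 h).1
  exact ⟨B, hBA, hB, ENNReal.toReal_pos h0.ne' (measure_ne_top _ _),
    (ENNReal.toReal_lt_toReal (measure_ne_top _ _) (measure_ne_top _ _)).2 h1⟩

/-- In an atomless finite measure space, sets of positive measure have arbitrarily small subsets of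
positive measure. -/
lemma Atomless.exists_small [IsFiniteMeasure P] (hP : Atomless P) {A : Set Ω}
    (hA : MeasurableSet A) (h : 0 < P.real A) {ε : ℝ} (hε : 0 < ε) :
    ∃ B ⊆ A, MeasurableSet B ∧ 0 < P.real B ∧ P.real B ≤ ε := by
  have key : ∀ k : ℕ, ∃ B ⊆ A, MeasurableSet B ∧ 0 < P.real B ∧
      P.real B ≤ P.real A * (1 / 2) ^ k := by
    intro k
    induction k with
    | zero => exact ⟨A, subset_rfl, hA, h, by simp⟩
    | succ k ih =>
      obtain ⟨B, hBA, hB, h0, h1⟩ := ih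
      obtain ⟨C, hCB, hC, hC0, hC1⟩ := hP.exists_real hB h0
      have hd := measureReal_sdiff hCB hC (μ := P)
      rw [pow_succ]
      -- One of the two pieces `C` and `B \ C` has at most half the measure of `B`.
      rcases le_total (P.real C) (P.real B / 2) with h2 | h2
      · exact ⟨C, hCB.trans hBA, hC, hC0, by linarith⟩
      · exact ⟨B \ C, Set.sdiff_subset.trans hBA, hB.diff hC, by linarith, by linarith⟩
  have ht : Tendsto (fun k : ℕ => P.real A * (1 / 2 : ℝ) ^ k) atTop (𝓝 (P.real A * 0)) :=
    (tendsto_pow_atTop_nhds_zero_of_lt_one (by norm_num) (by norm_num)).const_mul _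
  rw [mul_zero] at ht
  obtain ⟨k, hk⟩ := (ht.eventually_lt_const hε).exists
  obtain ⟨B, hBA, hB, h0, h1⟩ := key k
  exact ⟨B, hBA, hB, h0, h1.trans hk.le⟩

/-- Sierpiński's theorem: an atomless probability measure takes every value in `[0, 1]`. -/
theorem Atomless.exists_measureReal_eq [IsProbabilityMeasure P] (hP : Atomless P) {q : ℝ}
    (h0 : 0 ≤ q) (h1 : q ≤ 1) : ∃ A, MeasurableSet A ∧ P.real A = q := by
  let G := {A : Set Ω // MeasurableSet A ∧ P.real A ≤ q}
  -- Greedy choice: `A'` realizes at least half of the gain in measure still available above `A`.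
  have step : ∀ A : G, ∃ A' : G, A.1 ⊆ A'.1 ∧
      ∀ C : G, A.1 ⊆ C.1 → P.real C.1 ≤ 2 * P.real A'.1 - P.real A.1 := by
    intro A
    let T : Set ℝ := (fun C : G => P.real C.1) '' {C : G | A.1 ⊆ C.1}
    have hT : BddAbove T := ⟨q, by rintro _ ⟨C, -, rfl⟩; exact C.2.2⟩
    have hAT : P.real A.1 ≤ sSup T := le_csSup hT ⟨A, Set.Subset.refl A.1, rfl⟩
    rcases hAT.eq_or_lt with he | hlt
    · refine ⟨A, subset_rfl, fun C hC => ?_⟩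
      have : P.real C.1 ≤ sSup T := le_csSup hT ⟨C, hC, rfl⟩
      linarith
    · obtain ⟨_, ⟨A', hA', rfl⟩, hlt'⟩ := exists_lt_of_lt_csSup
        (⟨_, A, Set.Subset.refl A.1, rfl⟩ : T.Nonempty)
        (show (P.real A.1 + sSup T) / 2 < sSup T by linarith)
      refine ⟨A', hA', fun C hC => ?_⟩
      have : P.real C.1 ≤ sSup T := le_csSup hT ⟨C, hC, rfl⟩
      simp only at hlt'
      linarith
  choose next hnext hmax using step
  let A : ℕ → G := fun k => Nat.rec ⟨∅, MeasurableSet.empty, by simpa using h0⟩ (fun _ => next) k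
  have hmono : Monotone fun k => (A k).1 := monotone_nat_of_le_succ fun k => hnext (A k)
  let U := ⋃ k, (A k).1
  have hU : MeasurableSet U := MeasurableSet.iUnion fun k => (A k).2.1
  have ht : Tendsto (fun k => P.real (A k).1) atTop (𝓝 (P.real U)) :=
    (ENNReal.tendsto_toReal (measure_ne_top _ _)).comp (tendsto_measure_iUnion_atTop hmono)
  have hUq : P.real U ≤ q := le_of_tendsto' ht fun k => (A k).2.2
  refine ⟨U, hU, hUq.antisymm (not_lt.1 fun hlt => ?_)⟩
  have hc : 0 < P.real Uᶜ := by
    rw [probReal_compl_eq_one_sub hU]; linarith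
  obtain ⟨D, hDU, hD, hD0, hD1⟩ := hP.exists_small hU.compl hc (sub_pos.2 hlt)
  have hUD : P.real (U ∪ D) = P.real U + P.real D :=
    measureReal_union (Set.disjoint_left.2 fun x hx hxD => hDU hxD hx) hD
  let C : G := ⟨U ∪ D, hU.union hD, by linarith⟩
  -- The greedy bound holds for `C` at every stage; in the limit it leaves no room for `D`.
  have hle : P.real C.1 ≤ 2 * P.real U - P.real U :=
    ge_of_tendsto' (((ht.comp (tendsto_add_atTop_nat 1)).const_mul 2).sub ht) fun k =>
      hmax (A k) C ((Set.subset_iUnion (fun k => (A k).1) k).trans Set.subset_union_left)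
  have : P.real C.1 = P.real U + P.real D := hUD
  linarith

end Atomless

/-! ### The quantile transform -/

section Quantile

variable (ν : Measure ℝ)

/-- Right-continuity of the cdf makes the infimum in the quantile attained, which gives the
nontrivial direction. -/
lemma leftQuantile_le_iff {t x : ℝ} (ht : t ∈ Set.Ioo (0 : ℝ) 1) :
    leftQuantile (fun x => cdf ν x) t ≤ x ↔ t ≤ cdf ν x := by
  have hbdd : BddBelow {x : ℝ | t ≤ cdf ν x} := by
    obtain ⟨b, hb⟩ := ((tendsto_cdf_atBot ν).eventually_lt_const ht.1).exists
    exact ⟨b, fun y hy => (not_lt.1 fun hlt =>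
      (hb.trans_le hy).not_ge (monotone_cdf ν hlt.le))⟩
  have hne : {x : ℝ | t ≤ cdf ν x}.Nonempty := by
    obtain ⟨b, hb⟩ := ((tendsto_cdf_atTop ν).eventually_const_lt ht.2).exists
    exact ⟨b, hb.le⟩
  refine ⟨fun h => ?_, fun h => csInf_le hbdd h⟩
  have hr : Tendsto (cdf ν) (𝓝[>] x) (𝓝 (cdf ν x)) :=
    ((cdf ν).right_continuous x).tendsto.mono_left (nhdsWithin_mono _ Set.Ioi_subset_Ici_self)
  refine ge_of_tendsto hr ?_
  filter_upwards [self_mem_nhdsWithin] with y hy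
  obtain ⟨z, hz, hzy⟩ := exists_lt_of_csInf_lt hne (lt_of_le_of_lt h hy)
  exact le_trans hz (monotone_cdf ν hzy.le)

lemma aemeasurable_leftQuantile :
    AEMeasurable (leftQuantile fun x => cdf ν x) (volume.restrict (Set.Ioo (0 : ℝ) 1)) :=
  aemeasurable_restrict_of_monotoneOn measurableSet_Ioo fun _ hs _ ht hst =>
    (leftQuantile_le_iff ν hs).2 (hst.trans ((leftQuantile_le_iff ν ht).1 le_rfl))

variable [IsProbabilityMeasure ν]

/-- The left quantile function transports the uniform distribution on `(0, 1)` to `ν`. -/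
lemma map_leftQuantile :
    (volume.restrict (Set.Ioo (0 : ℝ) 1)).map (leftQuantile fun x => cdf ν x) = ν := by
  have hp : IsProbabilityMeasure (volume.restrict (Set.Ioo (0 : ℝ) 1)) := ⟨by simp⟩
  have := Measure.isProbabilityMeasure_map (aemeasurable_leftQuantile ν)
  refine Measure.ext_of_Iic _ _ fun x => ?_
  rw [Measure.map_apply_of_aemeasurable (aemeasurable_leftQuantile ν) measurableSet_Iic,
    ← ofReal_cdf, Measure.restrict_apply' measurableSet_Ioo]
  have h1 : leftQuantile (fun x => cdf ν x) ⁻¹' Set.Iic x ∩ Set.Ioo 0 1 =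
      Set.Iic (cdf ν x) ∩ Set.Ioo 0 1 := by
    ext t
    exact and_congr_left fun ht => leftQuantile_le_iff ν ht
  rw [h1]
  apply le_antisymm
  · refine (measure_mono (t := Set.Ioc 0 (cdf ν x)) fun t ht => ⟨ht.2.1, ht.1⟩).trans ?_
    simp
  · refine le_trans ?_ (measure_mono (s := Set.Ioo 0 (cdf ν x)) fun t ht =>
      ⟨ht.2.le, ht.1, ht.2.trans_le (cdf_le_one ν x)⟩)
    simp

lemma integral_leftQuantile {g : ℝ → ℝ} (hg : Measurable g) :
    ∫ t in Set.Ioo (0 : ℝ) 1, g (leftQuantile (fun x => cdf ν x) t) = ∫ x, g x ∂ν := by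
  conv_rhs => rw [← map_leftQuantile ν]
  rw [integral_map (aemeasurable_leftQuantile ν) hg.aestronglyMeasurable]

end Quantile

/-! ### The Cantelli bound -/

/-- The smallest value at `x` of a cdf with mean `m` and variance at most `s`, as given by
Cantelli's inequality. -/
noncomputable def cantelliBound (m s x : ℝ) : ℝ := if m ≤ x then 1 - s / (s + (x - m) ^ 2) else 0

lemma cantelliBound_of_pos {m s : ℝ} (hs : 0 < s) (x : ℝ) :
    cantelliBound m s x = (x - m) ^ 2 / (s + (x - m) ^ 2) * (Set.Ici m).indicator 1 x := by
  have : s + (x - m) ^ 2 ≠ 0 := by positivity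
  by_cases h : m ≤ x
  · simp only [cantelliBound, h, if_true, Set.mem_Ici, Set.indicator_of_mem, Pi.one_apply]
    field_simp
    ring
  · simp [cantelliBound, h]

/-- At `x = m` the convention `0 / 0 = 0` yields the value `1`, as the point mass at `m` requires.
-/
lemma cantelliBound_zero (m x : ℝ) :
    cantelliBound m 0 x = (Set.Ici m).indicator 1 x := by
  by_cases h : m ≤ x <;> simp [cantelliBound, h]

lemma cantelliBound_nonneg {s : ℝ} (hs : 0 ≤ s) (m x : ℝ) : 0 ≤ cantelliBound m s x := by
  unfold cantelliBound
  split_ifs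
  · exact sub_nonneg.2 (div_le_one_of_le₀ (by nlinarith) (by positivity))
  · exact le_rfl

lemma cantelliBound_le_one {s : ℝ} (hs : 0 ≤ s) (m x : ℝ) : cantelliBound m s x ≤ 1 := by
  unfold cantelliBound
  split_ifs
  · exact sub_le_self _ (by positivity)
  · exact zero_le_one

lemma cantelliBound_lt {m s y x : ℝ} (hs : 0 < s) (hy : m ≤ y) (hyx : y < x) :
    cantelliBound m s y < cantelliBound m s x := by
  simp only [cantelliBound, hy, hy.trans hyx.le, if_true]
  have : (y - m) ^ 2 < (x - m) ^ 2 := by nlinarith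
  gcongr

/-- Clearing the denominator leaves non-strict polynomial inequalities in `(m, s)`, which also cover
the degenerate point `s = 0`, `m = x`. -/
lemma le_cantelliBound_iff {m s x a : ℝ} (hs : 0 ≤ s) (ha : 0 ≤ a) (ha' : a ≤ 1) :
    a ≤ cantelliBound m s x ↔ a = 0 ∨ m ≤ x ∧ a * (s + (x - m) ^ 2) ≤ (x - m) ^ 2 := by
  by_cases h : m ≤ x
  · simp only [cantelliBound, h, if_true, true_and]
    rcases (add_nonneg hs (sq_nonneg (x - m))).eq_or_lt with h0 | h0
    · have : s = 0 := by nlinarith [sq_nonneg (x - m)]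
      rw [← h0]
      simp [ha', sq_nonneg]
    · rw [le_sub_iff_add_le, ← le_sub_iff_add_le', div_le_iff₀ h0]
      constructor
      · intro h; right; linarith
      · rintro (h | h)
        · nlinarith [sq_nonneg (x - m)]
        · linarith
  · simp only [cantelliBound, h, if_false, false_and, or_false]
    exact ⟨fun h => h.antisymm ha, fun h => h.le⟩

/-- Cantelli's one-sided inequality, for cdfs. -/
lemma cantelliBound_le_cdf (ν : Measure ℝ) [IsProbabilityMeasure ν]
    (hν : MemLp (fun x : ℝ => x) 2 ν) {m s : ℝ} (hs : 0 ≤ s) (hm : ∫ x, x ∂ν = m)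
    (hv : ∫ x, (x - m) ^ 2 ∂ν ≤ s) (x : ℝ) : cantelliBound m s x ≤ cdf ν x := by
  unfold cantelliBound
  split_ifs with hx
  swap; · exact cdf_nonneg ν x
  have hi : Integrable (fun x : ℝ => x) ν := hν.integrable one_le_two
  have hL : MemLp (fun x : ℝ => x - m) 2 ν := hν.sub (memLp_const m)
  have hc : cdf ν x = 1 - ν.real (Set.Ioi x) := by
    rw [cdf_eq_real, ← Set.compl_Iic, probReal_compl_eq_one_sub measurableSet_Iic, sub_sub_cancel]
  -- At `x = m` the bound is trivial unless `s = 0`, when the distribution is concentrated at `m`.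
  rcases hx.eq_or_lt with rfl | hlt
  · rcases hs.eq_or_lt with rfl | hs
    · have h0 : ∫ x, (x - m) ^ 2 ∂ν = 0 := le_antisymm hv (integral_nonneg fun x => sq_nonneg _)
      rw [integral_eq_zero_iff_of_nonneg (fun x => sq_nonneg _) hL.integrable_sq] at h0
      have : ν (Set.Ioi m) = 0 := by
        refine measure_mono_null (fun y hy => ?_) (ae_iff.1 h0)
        have : (0 : ℝ) < y - m := sub_pos.2 hy
        simp only [Pi.zero_apply, Set.mem_ofPred_eq]
        positivity
      rw [hc, Measure.real, this]
      simp
    · simp [hs.ne', cdf_nonneg]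
  · have ht : 0 < x - m := sub_pos.2 hlt
    set t := x - m
    -- Markov's inequality is applied to `(y - m + u) ^ 2`; the shift `u = s / t` minimizes the
    -- resulting bound `(s + u ^ 2) / (t + u) ^ 2`.
    have hL2 : MemLp (fun y : ℝ => y - m + s / t) 2 ν := hL.add (memLp_const _)
    have hint : ∫ y, (y - m + s / t) ^ 2 ∂ν ≤ s + (s / t) ^ 2 := by
      have h1 : ∀ y : ℝ, (y - m + s / t) ^ 2 =
          (y - m) ^ 2 + ((2 * (s / t)) * (y - m) + (s / t) ^ 2) := fun y => by ring
      have h2 : ∫ y, (y - m) ∂ν = 0 := by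
        rw [integral_sub hi (integrable_const _), hm]; simp
      have hi2 : Integrable (fun y : ℝ => 2 * (s / t) * (y - m) + (s / t) ^ 2) ν :=
        ((hL.integrable one_le_two).const_mul _).add (integrable_const _)
      simp_rw [h1]
      rw [integral_add hL.integrable_sq hi2,
        integral_add ((hL.integrable one_le_two).const_mul _) (integrable_const _),
        integral_const_mul, h2]
      simpa using hv
    have hmk := mul_meas_ge_le_integral_of_nonneg (μ := ν)
      (ae_of_all _ fun y => sq_nonneg (y - m + s / t)) hL2.integrable_sq ((t + s / t) ^ 2)
    have hsub : ν.real (Set.Ioi x) ≤ ν.real {y | (t + s / t) ^ 2 ≤ (y - m + s / t) ^ 2} := by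
      refine measureReal_mono fun y hy => ?_
      have hxy : x < y := hy
      have : t ≤ y - m := sub_le_sub_right hxy.le m
      have : 0 ≤ s / t := by positivity
      simp only [Set.mem_ofPred_eq]
      gcongr
    rw [hc, sub_le_sub_iff_left]
    have hpos : 0 < t + s / t := by positivity
    have h3 : (t + s / t) ^ 2 * ν.real (Set.Ioi x) ≤ s + (s / t) ^ 2 :=
      (mul_le_mul_of_nonneg_left hsub (sq_nonneg _)).trans (hmk.trans hint)
    have h4 : ν.real (Set.Ioi x) ≤ (s + (s / t) ^ 2) / (t + s / t) ^ 2 := by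
      rw [le_div_iff₀ (by positivity)]; linarith
    refine h4.trans_eq ?_
    field_simp
    ring

lemma cantelliBound_le_of_mem_momentSet {m v : ℝ} {F : ℝ → ℝ} (hF : F ∈ momentSet m v) (x : ℝ) :
    cantelliBound m (v ^ 2) x ≤ F x := by
  obtain ⟨⟨ν, hν, hL, rfl⟩, hm, hv⟩ := hF
  rw [integral_leftQuantile ν (g := fun x => x) measurable_id] at hm
  rw [integral_leftQuantile ν (g := fun x => |x - m| ^ 2) (by fun_prop)] at hv
  simp_rw [sq_abs] at hv
  exact cantelliBound_le_cdf ν hL (sq_nonneg v) hm hv x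

/-! ### Portfolio distributions and sharpness of the bound -/

section Portfolio

variable {Ω : Type*} [MeasurableSpace Ω] {P : Measure Ω} {n : ℕ}
  {w mu : Fin n → ℝ} {S : Matrix (Fin n) (Fin n) ℝ}

lemma memLp_dotProduct {X : Ω → Fin n → ℝ} (hX : ∀ i, MemLp (fun ω => X ω i) 2 P) :
    MemLp (fun ω => w ⬝ᵥ X ω) 2 P := by
  simp only [dotProduct]
  exact memLp_finsetSum _ fun i _ => (hX i).const_mul (w i)

lemma measurable_dotProduct {X : Ω → Fin n → ℝ} (hX : Measurable X) :
    Measurable fun ω => w ⬝ᵥ X ω := by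
  simp only [dotProduct]
  fun_prop

variable [IsProbabilityMeasure P]

lemma portfolioCdf_mem_cdfSetTwo {X : Ω → Fin n → ℝ} (hm : Measurable X)
    (hX : ∀ i, MemLp (fun ω => X ω i) 2 P) : portfolioCdf P w X ∈ cdfSetTwo := by
  have hw := measurable_dotProduct (w := w) hm
  refine ⟨P.map fun ω => w ⬝ᵥ X ω, Measure.isProbabilityMeasure_map hw.aemeasurable, ?_, rfl⟩
  exact (memLp_map_measure_iff measurable_id.aestronglyMeasurable hw.aemeasurable).2
    (memLp_dotProduct hX)

lemma portfolioCdf_apply {X : Ω → Fin n → ℝ} (hX : Measurable X) (x : ℝ) :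
    portfolioCdf P w X x = P.real {ω | w ⬝ᵥ X ω ≤ x} := by
  have hw := measurable_dotProduct (w := w) hX
  have := Measure.isProbabilityMeasure_map (μ := P) hw.aemeasurable
  rw [portfolioCdf, cdf_eq_real, map_measureReal_apply hw measurableSet_Iic]
  rfl

lemma integral_dotProduct {X : Ω → Fin n → ℝ} (hX : ∀ i, MemLp (fun ω => X ω i) 2 P)
    (hmu : ∀ i, ∫ ω, X ω i ∂P = mu i) : ∫ ω, w ⬝ᵥ X ω ∂P = w ⬝ᵥ mu := by
  simp only [dotProduct]
  rw [integral_finsetSum _ fun i _ => ((hX i).integrable one_le_two).const_mul (w i)]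
  simp_rw [integral_const_mul, hmu]

lemma variance_dotProduct {X : Ω → Fin n → ℝ} (hX : ∀ i, MemLp (fun ω => X ω i) 2 P) :
    Var[fun ω => w ⬝ᵥ X ω; P] = w ⬝ᵥ (covMat P X).mulVec w := by
  rw [← covariance_self (memLp_dotProduct hX).aemeasurable]
  simp only [dotProduct, Matrix.mulVec]
  rw [covariance_fun_sum_fun_sum (fun i => (hX i).const_mul (w i))
    (fun i => (hX i).const_mul (w i))]
  simp_rw [covariance_const_mul_left, covariance_const_mul_right, Finset.mul_sum, covMat,
    Matrix.of_apply]
  exact Finset.sum_congr rfl fun i _ => Finset.sum_congr rfl fun j _ => by ring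

/-- Evaluating the positive semidefinite form `S - covMat P X` at `w` bounds the variance of `w ⬝ᵥ
X`. -/
lemma portfolioSet_subset_momentSet (hS : S.PosSemidef) :
    portfolioSet P w mu S ⊆ momentSet (w ⬝ᵥ mu) (Real.sqrt (w ⬝ᵥ S.mulVec w)) := by
  rintro _ ⟨hF, X, hm, hX, hmu, hC, rfl⟩
  have hw := measurable_dotProduct (w := w) hm
  have := Measure.isProbabilityMeasure_map (μ := P) hw.aemeasurable
  have hmean := integral_dotProduct (w := w) hX hmu
  have hs : 0 ≤ w ⬝ᵥ S.mulVec w := by simpa using hS.dotProduct_mulVec_nonneg w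
  refine ⟨hF, ?_, ?_⟩
  · refine (integral_leftQuantile (P.map fun ω => w ⬝ᵥ X ω) (g := fun x => x)
      measurable_id).trans ?_
    rw [integral_map hw.aemeasurable (by fun_prop), hmean]
  · refine (integral_leftQuantile (P.map fun ω => w ⬝ᵥ X ω) (g := fun x => |x - w ⬝ᵥ mu| ^ 2)
      (by fun_prop)).trans_le ?_
    rw [integral_map hw.aemeasurable (by fun_prop), Real.sq_sqrt hs]
    have hv := variance_dotProduct (w := w) hX
    rw [variance_eq_integral hw.aemeasurable, hmean] at hv
    simp_rw [sq_abs]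
    rw [hv]
    have := hC.dotProduct_mulVec_nonneg w
    rw [Matrix.sub_mulVec, dotProduct_sub] at this
    simpa using this

lemma portfolioCdf_const_mem (hS : S.PosSemidef) :
    portfolioCdf P w (fun _ => mu) ∈ portfolioSet P w mu S := by
  refine ⟨portfolioCdf_mem_cdfSetTwo measurable_const fun i => memLp_const _, fun _ => mu,
    measurable_const, fun i => memLp_const _, fun i => by simp, ?_, rfl⟩
  have : covMat P (fun _ : Ω => mu) = 0 := by
    ext i j
    simp [covMat]
  rwa [this, sub_zero]

lemma portfolioCdf_const_apply (x : ℝ) :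
    portfolioCdf P w (fun _ => mu) x = (Set.Ici (w ⬝ᵥ mu)).indicator 1 x := by
  rw [portfolioCdf_apply measurable_const]
  by_cases h : w ⬝ᵥ mu ≤ x <;> simp [h]

/-- Subtracting from a positive semidefinite matrix its rank one part in direction `w`. -/
lemma posSemidef_sub_vecMulVec (hS : S.PosSemidef) (hw : 0 < w ⬝ᵥ S.mulVec w) :
    (S - (w ⬝ᵥ S.mulVec w)⁻¹ • Matrix.vecMulVec (S.mulVec w) (S.mulVec w)).PosSemidef := by
  have hsymm : ∀ u v : Fin n → ℝ, u ⬝ᵥ S.mulVec v = v ⬝ᵥ S.mulVec u := fun u v => by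
    have hT : S.transpose = S := by
      rw [← Matrix.conjTranspose_eq_transpose_of_trivial]; exact hS.isHermitian
    rw [Matrix.dotProduct_mulVec, ← Matrix.mulVec_transpose, hT, dotProduct_comm]
  refine .of_dotProduct_mulVec_nonneg ?_ fun u => ?_
  · refine hS.isHermitian.sub ?_
    ext i j
    simp [Matrix.vecMulVec_apply, mul_comm]
  · set s := w ⬝ᵥ S.mulVec w
    -- Cauchy–Schwarz for the form `S`: test it on `u` minus its `S`-orthogonal projection onto `w`.
    have h := hS.dotProduct_mulVec_nonneg (u - (s⁻¹ * (u ⬝ᵥ S.mulVec w)) • w)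
    simp only [star_trivial, Matrix.mulVec_sub, Matrix.mulVec_smul, dotProduct_sub,
      sub_dotProduct, smul_dotProduct, dotProduct_smul, smul_eq_mul, Matrix.sub_mulVec,
      Matrix.smul_mulVec, Matrix.vecMulVec_mulVec, hsymm w u] at h ⊢
    rw [show w ⬝ᵥ S.mulVec w = s from rfl] at h
    rw [dotProduct_comm (S.mulVec w) u]
    simp only [MulOpposite.smul_eq_mul_unop, MulOpposite.unop_op]
    refine h.trans_eq ?_
    field_simp
    ring

/-- The random vector `mu + Y v` is admissible if `Y` is centred and `Var(Y) v vᵀ ≤ S`. -/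
lemma portfolioCdf_rankOne_mem {v : Fin n → ℝ} {Y : Ω → ℝ} (hm : Measurable Y) (hY : MemLp Y 2 P)
    (h0 : ∫ ω, Y ω ∂P = 0) (hv : (S - cov[Y, Y; P] • Matrix.vecMulVec v v).PosSemidef) :
    portfolioCdf P w (fun ω i => mu i + v i * Y ω) ∈ portfolioSet P w mu S := by
  have hX : Measurable fun ω i => mu i + v i * Y ω :=
    measurable_pi_lambda _ fun i => by fun_prop
  have hX2 : ∀ i, MemLp (fun ω => mu i + v i * Y ω) 2 P :=
    fun i => (memLp_const (mu i)).add (hY.const_mul (v i))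
  have hXmu : ∀ i, ∫ ω, (mu i + v i * Y ω) ∂P = mu i := fun i => by
    rw [integral_add (integrable_const _) ((hY.integrable one_le_two).const_mul _),
      integral_const_mul, h0]
    simp
  have hI : ∀ c : ℝ, Integrable (fun ω => c * Y ω) P :=
    fun c => (hY.integrable one_le_two).const_mul c
  have hcov : covMat P (fun ω i => mu i + v i * Y ω) = cov[Y, Y; P] • Matrix.vecMulVec v v := by
    ext i j
    rw [covMat, Matrix.of_apply, covariance_const_add_left (hI _),
      covariance_const_add_right (hI _), covariance_const_mul_left, covariance_const_mul_right,
      Matrix.smul_apply, Matrix.vecMulVec_apply, smul_eq_mul]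
    ring
  rw [← hcov] at hv
  exact ⟨portfolioCdf_mem_cdfSetTwo hX hX2, _, hX, hX2, hXmu, hv, rfl⟩

/-- The extremal law in Cantelli's inequality: `Y` equals `κ (1 - p)` with probability `p` and `-κ
p` otherwise. The condition on `t` says exactly that the upper atom lies strictly above `t`. -/
lemma exists_twoPoint (hP : Atomless P) {s p : ℝ} (hs : 0 ≤ s) (hp0 : 0 < p) (hp1 : p < 1) :
    ∃ Y : Ω → ℝ, Measurable Y ∧ MemLp Y 2 P ∧ ∫ ω, Y ω ∂P = 0 ∧ cov[Y, Y; P] = s ∧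
      ∀ t, 0 ≤ t → p * (s + t ^ 2) < s → P.real {ω | Y ω ≤ t} ≤ 1 - p := by
  obtain ⟨A, hA, rfl⟩ := hP.exists_measureReal_eq hp0.le hp1.le
  set p := P.real A
  have hq : 0 < 1 - p := sub_pos.2 hp1
  set κ := Real.sqrt (s / (p * (1 - p)))
  have hκ : κ ^ 2 = s / (p * (1 - p)) := Real.sq_sqrt (by positivity)
  let I : Ω → ℝ := A.indicator 1
  have hI : MemLp I 2 P := (memLp_const (1 : ℝ)).indicator hA
  have hIm : Measurable I := measurable_one.indicator hA
  have hIi : ∫ ω, I ω ∂P = p := integral_indicator_one hA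
  have hII : cov[I, I; P] = p * (1 - p) := by
    rw [covariance_eq_sub hI hI, hIi]
    have : I * I = I := by
      ext ω
      by_cases h : ω ∈ A <;> simp [I, h]
    rw [this, hIi]
    ring
  refine ⟨fun ω => κ * (I ω - p), by fun_prop, (hI.sub (memLp_const p)).const_mul κ, ?_, ?_, ?_⟩
  · rw [integral_const_mul, integral_sub (hI.integrable one_le_two) (integrable_const _), hIi]
    simp
  · have hi := hI.integrable one_le_two
    rw [covariance_const_mul_left, covariance_const_mul_right, covariance_sub_const_left hi,
      covariance_sub_const_right hi, hII, ← mul_assoc, ← sq, hκ]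
    field_simp
  · intro t ht hlt
    rw [← probReal_compl_eq_one_sub hA]
    refine measureReal_mono fun ω hω hωA => ?_
    have hle : κ * (1 - p) ≤ t := by simpa [I, hωA] using hω
    have h1 : (κ * (1 - p)) ^ 2 ≤ t ^ 2 := by gcongr
    have h2 : (κ * (1 - p)) ^ 2 = s * (1 - p) / p := by
      rw [mul_pow, hκ]
      field_simp
    rw [h2, div_le_iff₀ hp0] at h1
    linarith

lemma exists_mem_portfolioSet_lt (hP : Atomless P) (hS : S.PosSemidef)
    {x c : ℝ} (hc : cantelliBound (w ⬝ᵥ mu) (w ⬝ᵥ S.mulVec w) x < c) :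
    ∃ F ∈ portfolioSet P w mu S, F x < c := by
  have hs : 0 ≤ w ⬝ᵥ S.mulVec w := by simpa using hS.dotProduct_mulVec_nonneg w
  set s := w ⬝ᵥ S.mulVec w with hs_def
  by_cases h : w ⬝ᵥ mu ≤ x ∧ 0 < s
  · obtain ⟨hx, hs⟩ := h
    have hd : 0 < s + (x - w ⬝ᵥ mu) ^ 2 := by positivity
    simp only [cantelliBound, hx, if_true] at hc
    -- The upper bound on `p` puts the upper atom strictly beyond `x`, the bound `1 - c < p` makes
    -- the cdf there less than `c`, and the `0` in the maximum covers `c ≥ 1`.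
    obtain ⟨p, hp, hp'⟩ := exists_between
      (show max 0 (1 - c) < s / (s + (x - w ⬝ᵥ mu) ^ 2) from
        max_lt (by positivity) (by linarith))
    have hp0 : 0 < p := (le_max_left _ _).trans_lt hp
    have hpc : 1 - c < p := (le_max_right _ _).trans_lt hp
    have hp1 : p < 1 := hp'.trans_le (div_le_one_of_le₀ (by nlinarith) hd.le)
    obtain ⟨Y, hm, hY, h0, hv, hlt⟩ := exists_twoPoint hP hs.le hp0 hp1
    have hpsd := posSemidef_sub_vecMulVec hS hs
    rw [← hs_def] at hpsd
    -- This direction `v` satisfies `w ⬝ᵥ v = 1`, so the portfolio loss is `w ⬝ᵥ mu + Y`.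
    have hmem := portfolioCdf_rankOne_mem (w := w) (mu := mu) (S := S) (v := s⁻¹ • S.mulVec w)
      hm hY h0 (by
        rw [hv]
        convert hpsd using 2
        rw [Matrix.smul_vecMulVec, Matrix.vecMulVec_smul, smul_smul, smul_smul]
        field_simp)
    refine ⟨_, hmem, ?_⟩
    rw [portfolioCdf_apply (measurable_pi_lambda _ fun i => by fun_prop)]
    have hdot : ∀ ω, w ⬝ᵥ (fun i => mu i + (s⁻¹ • S.mulVec w) i * Y ω) =
        w ⬝ᵥ mu + Y ω := fun ω => by
      have : (fun i => mu i + (s⁻¹ • S.mulVec w) i * Y ω) =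
          mu + (s⁻¹ * Y ω) • S.mulVec w := by
        ext i
        simp only [Pi.add_apply, Pi.smul_apply, smul_eq_mul]
        ring
      rw [this, dotProduct_add, dotProduct_smul, ← hs_def, smul_eq_mul]
      field_simp
    simp_rw [hdot, ← le_sub_iff_add_le']
    have := hlt (x - w ⬝ᵥ mu) (sub_nonneg.2 hx) ((lt_div_iff₀ hd).1 hp')
    linarith
  · refine ⟨_, portfolioCdf_const_mem hS, ?_⟩
    rw [portfolioCdf_const_apply]
    by_cases hx : w ⬝ᵥ mu ≤ x
    · have : s = 0 := le_antisymm (not_lt.1 fun h0 => h ⟨hx, h0⟩) hs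
      rwa [this, cantelliBound_zero] at hc
    · simpa [cantelliBound, hx] using hc

/-- A sandwiched `M` allows one proof for both uncertainty sets. -/
lemma lowerExtremal_eq_cantelliBound (hP : Atomless P) (hS : S.PosSemidef) {M : Set (ℝ → ℝ)}
    (h1 : portfolioSet P w mu S ⊆ M)
    (h2 : M ⊆ momentSet (w ⬝ᵥ mu) (Real.sqrt (w ⬝ᵥ S.mulVec w))) :
    lowerExtremal M = cantelliBound (w ⬝ᵥ mu) (w ⬝ᵥ S.mulVec w) := by
  have hs : 0 ≤ w ⬝ᵥ S.mulVec w := by simpa using hS.dotProduct_mulVec_nonneg w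
  have hle : ∀ F ∈ M, ∀ x, cantelliBound (w ⬝ᵥ mu) (w ⬝ᵥ S.mulVec w) x ≤ F x := fun F hF x => by
    simpa [Real.sq_sqrt hs] using cantelliBound_le_of_mem_momentSet (h2 hF) x
  ext x
  refine csInf_eq_of_forall_ge_of_forall_gt_exists_lt
    (Set.Nonempty.image _ ⟨_, h1 (portfolioCdf_const_mem hS)⟩) ?_ fun c hc => ?_
  · rintro _ ⟨F, hF, rfl⟩
    exact hle F hF x
  · obtain ⟨F, hF, hlt⟩ := exists_mem_portfolioSet_lt hP hS hc
    exact ⟨_, ⟨F, h1 hF, rfl⟩, hlt⟩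

end Portfolio

/-! ### Lambda-quantiles of envelopes and existence of minimizers -/

section Quantiles

variable {Lam : ℝ → ℝ}

lemma qTildeMinus_anti {f g : ℝ → ℝ} (h : f ≤ g) : qTildeMinus Lam g ≤ qTildeMinus Lam f :=
  sSup_le_sSup (Set.image_mono fun x hx => (h x).trans_lt hx)

lemma qTildePlus_anti {f g : ℝ → ℝ} (h : f ≤ g) : qTildePlus Lam g ≤ qTildePlus Lam f :=
  sSup_le_sSup (Set.image_mono fun x hx => (h x).trans hx)

lemma qTildeMinus_le_iff {f : ℝ → ℝ} {c : EReal} :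
    qTildeMinus Lam f ≤ c ↔ ∀ x : ℝ, c < x → Lam x ≤ f x := by
  rw [qTildeMinus, sSup_le_iff, Set.forall_mem_image]
  exact forall_congr' fun x => by
    rw [← not_imp_not, not_le]; simp

lemma qTildePlus_le_iff {f : ℝ → ℝ} {c : EReal} :
    qTildePlus Lam f ≤ c ↔ ∀ x : ℝ, c < x → Lam x < f x := by
  rw [qTildePlus, sSup_le_iff, Set.forall_mem_image]
  exact forall_congr' fun x => by
    rw [← not_imp_not, not_le]; simp

lemma iSup_qTildeMinus {M : Set (ℝ → ℝ)} {f : ℝ → ℝ} (hle : ∀ F ∈ M, f ≤ F)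
    (hlt : ∀ x c, f x < c → ∃ F ∈ M, F x < c) :
    ⨆ F ∈ M, qTildeMinus Lam F = qTildeMinus Lam f := by
  refine le_antisymm (iSup₂_le fun F hF => qTildeMinus_anti (hle F hF)) (sSup_le ?_)
  rintro _ ⟨x, hx, rfl⟩
  obtain ⟨F, hF, hFx⟩ := hlt x _ hx
  have hx : (x : EReal) ≤ qTildeMinus Lam F := le_sSup ⟨x, hFx, rfl⟩
  exact hx.trans (le_iSup₂ (f := fun F _ => qTildeMinus Lam F) F hF)

/-- The envelope value at `x` need only be reached by members at points `z` arbitrarily close to `x`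
from the left, since `Lam x ≤ Lam z`. -/
lemma iSup_qTildePlus (hLam : Antitone Lam) {M : Set (ℝ → ℝ)} {f : ℝ → ℝ}
    (hle : ∀ F ∈ M, f ≤ F)
    (hlt : ∀ x y, y < x → ∃ z, y < z ∧ z ≤ x ∧ ∃ F ∈ M, F z ≤ f x) :
    ⨆ F ∈ M, qTildePlus Lam F = qTildePlus Lam f := by
  refine le_antisymm (iSup₂_le fun F hF => qTildePlus_anti (hle F hF)) (sSup_le ?_)
  rintro _ ⟨x, hx, rfl⟩
  refine le_of_forall_lt fun c hc => ?_
  obtain ⟨y, hcy, hyx⟩ := EReal.lt_iff_exists_real_btwn.1 hc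
  obtain ⟨z, hyz, hzx, F, hF, hFz⟩ := hlt x y (EReal.coe_lt_coe_iff.1 hyx)
  have hz : F z ≤ Lam z := hFz.trans (le_trans hx (hLam hzx))
  calc c < y := hcy
    _ < z := EReal.coe_lt_coe_iff.2 hyz
    _ ≤ qTildePlus Lam F := le_sSup ⟨z, hz, rfl⟩
    _ ≤ _ := le_iSup₂ (f := fun F _ => qTildePlus Lam F) F hF

/-- For `Lam` decreasing, the sublevel sets of `qTildePlus` on the Cantelli bounds are described by
non-strict inequalities in the mean and the variance. -/
lemma qTildePlus_cantelliBound_le_iff (hLam : Antitone Lam)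
    (h01 : ∀ x, Lam x ∈ Set.Icc (0 : ℝ) 1) {m s : ℝ} (hs : 0 ≤ s) {c : EReal} :
    qTildePlus Lam (cantelliBound m s) ≤ c ↔
      (m : EReal) ≤ c ∧ ∀ x : ℝ, c < x → Lam x < 1 ∧ Lam x ≤ cantelliBound m s x := by
  rw [qTildePlus_le_iff]
  constructor
  · refine fun h => ⟨not_lt.1 fun hlt => ?_, fun x hx =>
      ⟨(h x hx).trans_le (cantelliBound_le_one hs m x), (h x hx).le⟩⟩
    obtain ⟨x, hcx, hxm⟩ := EReal.lt_iff_exists_real_btwn.1 hlt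
    have := h x hcx
    rw [cantelliBound, if_neg (EReal.coe_lt_coe_iff.1 hxm).not_ge] at this
    exact this.not_ge (h01 x).1
  · rintro ⟨hm, h⟩ x hx
    have hmx : m < x := EReal.coe_lt_coe_iff.1 (hm.trans_lt hx)
    rcases hs.eq_or_lt with rfl | hs
    · rw [cantelliBound_zero]
      simpa [hmx.le] using (h x hx).1
    -- Strictness at `x` comes from the non-strict inequality at an intermediate `y`, as the bound
    -- is strictly increasing beyond `m`.
    · obtain ⟨y, hcy, hyx⟩ := EReal.lt_iff_exists_real_btwn.1 hx
      have hyx := EReal.coe_lt_coe_iff.1 hyx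
      have hmy : m < y := EReal.coe_lt_coe_iff.1 (hm.trans_lt hcy)
      exact ((hLam hyx.le).trans (h y hcy).2).trans_lt (cantelliBound_lt hs hmy.le hyx)

variable {α : Type*} [TopologicalSpace α] {m s : α → ℝ}

/-- The bound is not jointly continuous at mean `x` and variance `0`, but its superlevel sets are
still closed. -/
lemma isClosed_setOf_le_cantelliBound {K : Set α} (hK : IsClosed K) (hm : Continuous m)
    (hs : Continuous s) (hs0 : ∀ a ∈ K, 0 ≤ s a) {c : ℝ} (hc : c ∈ Set.Icc (0 : ℝ) 1) (x : ℝ) :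
    IsClosed {a | a ∈ K ∧ c ≤ cantelliBound (m a) (s a) x} := by
  have : {a | a ∈ K ∧ c ≤ cantelliBound (m a) (s a) x} =
      K ∩ ({_a | c = 0} ∪
        ({a | m a ≤ x} ∩ {a | c * (s a + (x - m a) ^ 2) ≤ (x - m a) ^ 2})) := by
    ext a
    exact and_congr_right fun ha => le_cantelliBound_iff (hs0 a ha) hc.1 hc.2
  rw [this]
  exact hK.inter (isClosed_const.union ((isClosed_le hm continuous_const).inter
    (isClosed_le (by fun_prop) (by fun_prop))))

/-- A function with closed sublevel sets in a nonempty compact set attains its minimum. -/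
lemma exists_isMinOn_of_isClosed {K : Set α} (hK : IsCompact K) (hne : K.Nonempty)
    {g : α → EReal} (hg : ∀ c, IsClosed {a | a ∈ K ∧ g a ≤ c}) : ∃ a ∈ K, IsMinOn g K a := by
  refine LowerSemicontinuousOn.exists_isMinOn hne hK ?_
  rw [lowerSemicontinuousOn_iff_preimage_Iic]
  exact fun c => ⟨_, hg c, by ext a; simp⟩

lemma exists_isMinOn_cantelliBound {K : Set α} (hK : IsCompact K) (hKc : IsClosed K)
    (hne : K.Nonempty) (hm : Continuous m) (hs : Continuous s) (hs0 : ∀ a ∈ K, 0 ≤ s a)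
    (h01 : ∀ x, Lam x ∈ Set.Icc (0 : ℝ) 1) {rho : (ℝ → ℝ) → EReal}
    (hrho : rho = qTildeMinus Lam ∨ (Antitone Lam ∧ rho = qTildePlus Lam)) :
    ∃ a ∈ K, IsMinOn (fun a => rho (cantelliBound (m a) (s a))) K a := by
  have hcl := fun x => isClosed_setOf_le_cantelliBound hKc hm hs hs0 (h01 x) x
  refine exists_isMinOn_of_isClosed hK hne fun c => ?_
  rcases hrho with rfl | ⟨hLam, rfl⟩
  · have : {a | a ∈ K ∧ qTildeMinus Lam (cantelliBound (m a) (s a)) ≤ c} =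
        K ∩ ⋂ (x : ℝ) (_ : c < x), {a | a ∈ K ∧ Lam x ≤ cantelliBound (m a) (s a) x} := by
      ext a
      simp only [qTildeMinus_le_iff, Set.mem_inter_iff, Set.mem_iInter, Set.mem_ofPred_eq]
      exact and_congr_right fun ha => by simp [ha]
    rw [this]
    exact hKc.inter (isClosed_iInter fun x => isClosed_iInter fun _ => hcl x)
  · have : {a | a ∈ K ∧ qTildePlus Lam (cantelliBound (m a) (s a)) ≤ c} =
        (K ∩ {a | (m a : EReal) ≤ c}) ∩ ⋂ (x : ℝ) (_ : c < x),
          ({_a | Lam x < 1} ∩ {a | a ∈ K ∧ Lam x ≤ cantelliBound (m a) (s a) x}) := by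
      ext a
      simp only [Set.mem_inter_iff, Set.mem_iInter, Set.mem_ofPred_eq, and_assoc]
      exact and_congr_right fun ha => by
        simp [ha, qTildePlus_cantelliBound_le_iff hLam h01 (hs0 a ha)]
    rw [this]
    refine (hKc.inter (isClosed_le (continuous_coe_real_ereal.comp hm) continuous_const)).inter
      (isClosed_iInter fun x => isClosed_iInter fun _ => isClosed_const.inter (hcl x))

end Quantiles

/-! ### Worst-case risk and the main theorem -/

/-- The worst-case risk of a portfolio is the risk of the Cantelli bound. -/
lemma iSup_portfolioSet {Ω : Type*} [MeasurableSpace Ω] {P : Measure Ω} [IsProbabilityMeasure P]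
    (hP : Atomless P) {n : ℕ} {w mu : Fin n → ℝ} {S : Matrix (Fin n) (Fin n) ℝ}
    (hS : S.PosSemidef) {Lam : ℝ → ℝ} {rho : (ℝ → ℝ) → EReal}
    (hrho : rho = qTildeMinus Lam ∨ (Antitone Lam ∧ rho = qTildePlus Lam)) :
    ⨆ F ∈ portfolioSet P w mu S, rho F =
      rho (cantelliBound (w ⬝ᵥ mu) (w ⬝ᵥ S.mulVec w)) := by
  have hs : 0 ≤ w ⬝ᵥ S.mulVec w := by simpa using hS.dotProduct_mulVec_nonneg w
  have hle : ∀ F ∈ portfolioSet P w mu S, cantelliBound (w ⬝ᵥ mu) (w ⬝ᵥ S.mulVec w) ≤ F :=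
    fun F hF x => by
      simpa [Real.sq_sqrt hs] using
        cantelliBound_le_of_mem_momentSet (portfolioSet_subset_momentSet hS hF) x
  rcases hrho with rfl | ⟨hLam, rfl⟩
  · exact iSup_qTildeMinus hle fun x c => exists_mem_portfolioSet_lt hP hS
  · refine iSup_qTildePlus hLam hle fun x y hyx => ?_
    -- The constant vector attains the envelope if the variance is `0`, and everywhere left of the
    -- mean. Beyond the mean, the envelope at `z < x` is strictly below its value at `x`, which
    -- leaves room for a near-minimizer.
    rcases hs.eq_or_lt with h0 | h0
    · refine ⟨x, hyx, le_rfl, _, portfolioCdf_const_mem hS, ?_⟩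
      rw [portfolioCdf_const_apply, ← h0, cantelliBound_zero]
    rcases le_or_gt x (w ⬝ᵥ mu) with hx | hx
    · obtain ⟨z, hyz, hzx⟩ := exists_between hyx
      refine ⟨z, hyz, hzx.le, _, portfolioCdf_const_mem hS, ?_⟩
      have hz : z ∉ Set.Ici (w ⬝ᵥ mu) := (hzx.trans_le hx).not_ge
      rw [portfolioCdf_const_apply, Set.indicator_of_notMem hz]
      exact cantelliBound_nonneg hs _ _
    · obtain ⟨z, hyz, hzx⟩ := exists_between (max_lt hyx hx)
      obtain ⟨F, hF, hlt⟩ := exists_mem_portfolioSet_lt hP hS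
        (cantelliBound_lt h0 ((le_max_right _ _).trans hyz.le) hzx)
      exact ⟨z, (le_max_left _ _).trans_lt hyz, hzx.le, F, hF, hlt.le⟩

end RobustLambda

open RobustLambda in
theorem mainTheorem12 {Ω : Type*} [MeasurableSpace Ω] (P : MeasureTheory.Measure Ω)
    [MeasureTheory.IsProbabilityMeasure P] (hP : Atomless P)
    (n : ℕ) (hn : 1 ≤ n) (mu : Fin n → ℝ) (S : Matrix (Fin n) (Fin n) ℝ) (hS : S.PosSemidef)
    (Lam : ℝ → ℝ) (hLam : ∀ x, Lam x ∈ Set.Icc (0 : ℝ) 1)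
    (rho : (ℝ → ℝ) → EReal)
    (hrho : rho = qTildeMinus Lam ∨ (Antitone Lam ∧ rho = qTildePlus Lam)) :
    -- both minima exist and they are equal
    (∃ c : EReal,
      IsLeast ((fun w => ⨆ F ∈ portfolioSet P w mu S, rho F) '' stdSimplex ℝ (Fin n)) c ∧
      IsLeast ((fun w => rho (lowerExtremal (momentSet (w ⬝ᵥ mu) (Real.sqrt (w ⬝ᵥ S.mulVec w)))))
        '' stdSimplex ℝ (Fin n)) c) ∧
    -- the extremal function is explicit
    (∀ w ∈ stdSimplex ℝ (Fin n),
      lowerExtremal (momentSet (w ⬝ᵥ mu) (Real.sqrt (w ⬝ᵥ S.mulVec w))) =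
        lowerExtremal (portfolioSet P w mu S) ∧
      (0 < w ⬝ᵥ S.mulVec w → ∀ x : ℝ, lowerExtremal (portfolioSet P w mu S) x =
        (x - w ⬝ᵥ mu) ^ 2 / (w ⬝ᵥ S.mulVec w + (x - w ⬝ᵥ mu) ^ 2) *
          (Set.Ici (w ⬝ᵥ mu)).indicator 1 x) ∧
      (w ⬝ᵥ S.mulVec w = 0 → ∀ x : ℝ, lowerExtremal (portfolioSet P w mu S) x =
        (Set.Ici (w ⬝ᵥ mu)).indicator 1 x)) ∧
    -- the optimal portfolios are exactly the minimizers of the right-hand side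
    (∀ w ∈ stdSimplex ℝ (Fin n),
      IsMinOn (fun w => ⨆ F ∈ portfolioSet P w mu S, rho F) (stdSimplex ℝ (Fin n)) w ↔
      IsMinOn (fun w => rho (lowerExtremal
        (momentSet (w ⬝ᵥ mu) (Real.sqrt (w ⬝ᵥ S.mulVec w))))) (stdSimplex ℝ (Fin n)) w) := by
  have hs : ∀ w : Fin n → ℝ, 0 ≤ w ⬝ᵥ S.mulVec w := fun w => by
    simpa using hS.dotProduct_mulVec_nonneg w
  have hM : ∀ w : Fin n → ℝ,
      lowerExtremal (momentSet (w ⬝ᵥ mu) (Real.sqrt (w ⬝ᵥ S.mulVec w))) =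
        cantelliBound (w ⬝ᵥ mu) (w ⬝ᵥ S.mulVec w) := fun w =>
    lowerExtremal_eq_cantelliBound hP hS (portfolioSet_subset_momentSet hS) subset_rfl
  have hE : ∀ w : Fin n → ℝ, lowerExtremal (portfolioSet P w mu S) =
      cantelliBound (w ⬝ᵥ mu) (w ⬝ᵥ S.mulVec w) := fun w =>
    lowerExtremal_eq_cantelliBound hP hS subset_rfl (portfolioSet_subset_momentSet hS)
  -- Both objectives become the same function of `w`, so the equality of minima and of minimizers is
  -- immediate.
  simp only [hM, hE, iSup_portfolioSet hP hS hrho, and_self, true_and, iff_self, implies_true,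
    and_true]
  refine ⟨?_, fun w _ => ⟨fun h x => cantelliBound_of_pos h x, fun h x => ?_⟩⟩
  · have : Nonempty (Fin n) := ⟨⟨0, hn⟩⟩
    obtain ⟨w, hw, hmin⟩ := exists_isMinOn_cantelliBound (K := stdSimplex ℝ (Fin n))
      (m := fun w => w ⬝ᵥ mu) (s := fun w => w ⬝ᵥ S.mulVec w)
      (isCompact_stdSimplex ℝ (Fin n)) (isClosed_stdSimplex ℝ (Fin n))
      ⟨_, single_mem_stdSimplex ℝ (Classical.arbitrary (Fin n))⟩
      (by fun_prop) (by fun_prop) (fun w _ => hs w) hLam hrho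
    refine ⟨_, ⟨w, hw, rfl⟩, ?_⟩
    rintro _ ⟨w', hw', rfl⟩
    exact hmin hw'
  · rw [h, cantelliBound_zero]
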